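/- For integers $r\ge 1$, $k_1\ge 2$ and $k_2,\dots,k_r\ge 1$ let $$\zeta^\star(k_1,\dots,k_r)=\sum_{n_1\ge\cdots\ge n_r\ge 1}\frac{1}{n_1^{k_1}\cdots n_r^{k_r}}.$$ Let $\mathcal T$ be the set of infinite sequences $\mathbf k=(k_1,k_2,\dots)$ of positive integers with $k_1\ge 2$ and such that, if $k_1=2$, then $k_s\ge 2$ for some $s\ge 2$. For $\mathbf k\in\mathcal T$ the limit $\eta(\mathbf k)=\lim_{r\to\infty}\zeta^\star(k_1,\dots,k_r)$ exists in $\mathbb R$. For integers $p,q\geq 2$ put $$\mathcal T_p=\{\mathbf k\in\mathcal T: k_i\ge p\text{ for all } i\ge 1\},\qquad \mathcal D_q=\{\mathbf k\in\mathcal T: k_i\le q\text{ for all } i\ge 1\},$$ and let $\dim_H$ denote the Hausdorff dimension of a subset of $\mathbb R$. (i) For every $p\ge 2$ the equation $x^{p-1}(x-1)=1$ has a unique root $\alpha_p$ in $(1,2)$, and $$\dim_H\eta(\mathcal T_p)=\frac{\log\alpha_p}{\log 2}.$$ (ii) For all $2\le p<q$ the equation $x^p+x^{p+1}+\cdots+x^q=1$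 has a unique root $\gamma_{p,q}$ in $(0,1)$, and $$\dim_H\eta(\mathcal T_p\cap\mathcal D_q)=\frac{\log(1/\gamma_{p,q})}{\log 2}.$$ (iii) For every $q\ge 3$, $$\dim_H\eta(\mathcal D_q)\ge\frac{\log(1/\gamma_{2,q})}{\log 2}.$$ -/

import Mathlib

open Set Filter Topology MeasureTheory

namespace ZetaStar

/-- The summation range `n₁ ≥ n₂ ≥ ⋯ ≥ n_r ≥ 1`. -/
def starIndex (r : ℕ) : Set (Fin r → ℕ) :=
  {n | Antitone n ∧ ∀ i, 1 ≤ n i}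

/-- The summand `1 / (n₁ ^ k₁ ⋯ n_r ^ k_r)`. A sequence `(k₁, k₂, …)` is a function
`k : ℕ → ℕ` whose entry `k_i` is the value `k (i - 1)`. -/
noncomputable def starTerm (k : ℕ → ℕ) (r : ℕ) (n : Fin r → ℕ) : ℝ :=
  1 / ∏ i : Fin r, (n i : ℝ) ^ k i

/-- The multiple zeta-star value `ζ⋆(k₁, …, k_r)` of the first `r` entries of `k`. -/
noncomputable def zetaStar (k : ℕ → ℕ) (r : ℕ) : ℝ :=
  ∑' n : starIndex r, starTerm k r n

/-- The set `𝒯` of sequences of positive integers with `k₁ ≥ 2` and, if `k₁ = 2`, with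
`k_s ≥ 2` for some `s ≥ 2`. -/
def seqT : Set (ℕ → ℕ) :=
  {k | 2 ≤ k 0 ∧ (∀ i, 1 ≤ k i) ∧ (k 0 = 2 → ∃ s, 1 ≤ s ∧ 2 ≤ k s)}

/-- The set `𝒯_p` of sequences in `𝒯` all of whose entries are at least `p`. -/
def seqTp (p : ℕ) : Set (ℕ → ℕ) :=
  {k | k ∈ seqT ∧ ∀ i, p ≤ k i}

/-- The set `𝒟_q` of sequences in `𝒯` all of whose entries are at most `q`. -/
def seqD (q : ℕ) : Set (ℕ → ℕ) :=
  {k | k ∈ seqT ∧ ∀ i, k i ≤ q}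

/-- The map `η`, `k ↦ lim_{r → ∞} ζ⋆(k₁, …, k_r)`. On `𝒯` the series converge and the limit
exists: see `summable_starTerm` and `tendsto_eta` below. -/
noncomputable def eta (k : ℕ → ℕ) : ℝ :=
  limUnder atTop (fun r => zetaStar k r)

/-! The remaining facts show that `eta` is well defined on `seqT`. -/

/-- Truncated sum in the extended nonnegative reals, with largest index at most `N`. -/
noncomputable def truncSum (k : ℕ → ℕ) (r N : ℕ) : ENNReal :=
  ∑' n : {n : Fin r → ℕ // n ∈ starIndex r ∧ ∀ i, n i ≤ N}, ENNReal.ofReal (starTerm k r n)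

theorem starTerm_nonneg (k : ℕ → ℕ) (r : ℕ) (n : Fin r → ℕ) : 0 ≤ starTerm k r n := by
  unfold starTerm; positivity

theorem starTerm_succ (k : ℕ → ℕ) (r : ℕ) (n : Fin (r + 1) → ℕ) :
    starTerm k (r + 1) n
      = 1 / (n 0 : ℝ) ^ k 0 * starTerm (fun i => k (i + 1)) r (fun i => n i.succ) := by
  unfold starTerm
  rw [Fin.prod_univ_succ, one_div_mul_one_div]
  simp

theorem sum_le_sigma (k : ℕ → ℕ) (r : ℕ) (A : Set ℕ) :
    (∑' n : {n : Fin (r + 1) → ℕ // n ∈ starIndex (r + 1) ∧ n 0 ∈ A},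
      ENNReal.ofReal (starTerm k (r + 1) n))
      ≤ ∑' m : {m : ℕ // 1 ≤ m ∧ m ∈ A}, ENNReal.ofReal (1 / (m : ℝ) ^ k 0) *
          truncSum (fun i => k (i + 1)) r m := by
  unfold truncSum
  simp_rw [← ENNReal.tsum_mul_left]
  rw [← ENNReal.tsum_sigma' (β := fun m : {m : ℕ // 1 ≤ m ∧ m ∈ A} =>
    {n : Fin r → ℕ // n ∈ starIndex r ∧ ∀ i, n i ≤ m})
    (f := fun x => ENNReal.ofReal (1 / (x.1.1 : ℝ) ^ k 0) *
      ENNReal.ofReal (starTerm (fun i => k (i + 1)) r x.2.1))]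
  let φ : {n : Fin (r + 1) → ℕ // n ∈ starIndex (r + 1) ∧ n 0 ∈ A} →
      (Σ m : {m : ℕ // 1 ≤ m ∧ m ∈ A},
        {n : Fin r → ℕ // n ∈ starIndex r ∧ ∀ i, n i ≤ m}) :=
    fun n => ⟨⟨n.1 0, n.2.1.2 0, n.2.2⟩, ⟨fun i => n.1 i.succ,
      ⟨fun i j h => n.2.1.1 (Fin.succ_le_succ_iff.2 h), fun i => n.2.1.2 _⟩,
      fun i => n.2.1.1 (Fin.zero_le _)⟩⟩
  let ψ : (Σ m : {m : ℕ // 1 ≤ m ∧ m ∈ A},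
        {n : Fin r → ℕ // n ∈ starIndex r ∧ ∀ i, n i ≤ m}) → (Fin (r + 1) → ℕ) :=
    fun x => Fin.cons x.1.1 x.2.1
  have hφ : Function.Injective φ := by
    intro a b h
    have h2 := congrArg ψ h
    have e : ∀ c, ψ (φ c) = c.1 := fun c => Fin.cons_self_tail c.1
    rw [e, e] at h2
    exact Subtype.ext h2
  refine le_trans (le_of_eq ?_) (ENNReal.tsum_comp_le_tsum_of_injective hφ _)
  congr 1
  ext n
  rw [starTerm_succ, ENNReal.ofReal_mul (by positivity)]

theorem truncSum_succ_le (k : ℕ → ℕ) (r N : ℕ) :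
    truncSum k (r + 1) N ≤ ∑ m ∈ Finset.Icc 1 N, ENNReal.ofReal (1 / (m : ℝ) ^ k 0) *
      truncSum (fun i => k (i + 1)) r m := by
  have h := sum_le_sigma k r {m | m ≤ N}
  refine le_trans ?_ (h.trans (le_of_eq ?_))
  · unfold truncSum
    exact ENNReal.tsum_comp_le_tsum_of_injective
      (f := fun n : {n : Fin (r + 1) → ℕ // n ∈ starIndex (r + 1) ∧ ∀ i, n i ≤ N} =>
        (⟨n.1, n.2.1, n.2.2 0⟩ : {n : Fin (r + 1) → ℕ // n ∈ starIndex (r + 1) ∧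
          n 0 ∈ {m | m ≤ N}}))
      (fun a b h => Subtype.ext (congrArg (fun x => x.1) h))
      (fun n => ENNReal.ofReal (starTerm k (r + 1) n.1))
  · rw [← Finset.tsum_subtype (Finset.Icc 1 N)
      (fun m => ENNReal.ofReal (1 / (m : ℝ) ^ k 0) * truncSum (fun i => k (i + 1)) r m)]
    exact Equiv.tsum_eq (Equiv.subtypeEquivRight (p := fun m => 1 ≤ m ∧ m ∈ {m | m ≤ N})
      (q := fun m => m ∈ Finset.Icc 1 N) (fun m => by simp))
      (fun x : {m // m ∈ Finset.Icc 1 N} => ENNReal.ofReal (1 / ((x : ℕ) : ℝ) ^ k 0) *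
        truncSum (fun i => k (i + 1)) r x)

theorem truncSum_zero (k : ℕ → ℕ) (N : ℕ) : truncSum k 0 N ≤ 1 := by
  unfold truncSum
  have : Subsingleton {n : Fin 0 → ℕ // n ∈ starIndex 0 ∧ ∀ i, n i ≤ N} :=
    ⟨fun a b => Subtype.ext (Subsingleton.elim _ _)⟩
  rw [tsum_eq_single (⟨Fin.elim0, ⟨fun i => i.elim0, fun i => i.elim0⟩, fun i => i.elim0⟩ :
    {n : Fin 0 → ℕ // n ∈ starIndex 0 ∧ ∀ i, n i ≤ N})
    (fun b hb => absurd (Subsingleton.elim _ _) hb)]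
  simp [starTerm]

theorem truncSum_step (k : ℕ → ℕ) (r N : ℕ) (f g : ℕ → ℝ) (hf : ∀ m, 0 ≤ f m)
    (h : ∀ m, 1 ≤ m → truncSum (fun i => k (i + 1)) r m ≤ ENNReal.ofReal (f m))
    (hg : ∑ m ∈ Finset.Icc 1 N, 1 / (m : ℝ) ^ k 0 * f m ≤ g N) :
    truncSum k (r + 1) N ≤ ENNReal.ofReal (g N) := by
  refine (truncSum_succ_le k r N).trans ?_
  refine le_trans ?_ (ENNReal.ofReal_le_ofReal hg)
  rw [ENNReal.ofReal_sum_of_nonneg (fun m _ => mul_nonneg (by positivity) (hf m))]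
  refine Finset.sum_le_sum fun m hm => ?_
  rw [ENNReal.ofReal_mul (by positivity)]
  gcongr
  exact h m (Finset.mem_Icc.1 hm).1

theorem one_div_pow_le {a b m : ℕ} (h : a ≤ b) (hm : 1 ≤ m) :
    1 / (m : ℝ) ^ b ≤ 1 / (m : ℝ) ^ a := by
  have : (1 : ℝ) ≤ m := by exact_mod_cast hm
  exact one_div_le_one_div_of_le (by positivity) (pow_le_pow_right₀ this h)

theorem truncSum_le_self (r : ℕ) : ∀ k : ℕ → ℕ, (∀ i, 1 ≤ k i) → ∀ N : ℕ, 1 ≤ N →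
    truncSum k r N ≤ ENNReal.ofReal N := by
  induction r with
  | zero =>
    intro k _ N hN
    exact (truncSum_zero k N).trans (by simpa using hN)
  | succ r ih =>
    intro k hk N hN
    refine truncSum_step k r N (fun m => (m : ℝ)) (fun m => (m : ℝ)) (fun m => by positivity)
      (ih _ fun i => hk _) ?_
    calc ∑ m ∈ Finset.Icc 1 N, 1 / (m : ℝ) ^ k 0 * m ≤ ∑ m ∈ Finset.Icc 1 N, (1 : ℝ) := by
          refine Finset.sum_le_sum fun m hm => ?_
          have h1 := (Finset.mem_Icc.1 hm).1
          have h2 : (0 : ℝ) < m := by exact_mod_cast h1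
          calc 1 / (m : ℝ) ^ k 0 * m ≤ 1 / (m : ℝ) ^ 1 * m := by
                gcongr ?_ * _
                exact one_div_pow_le (hk 0) h1
            _ = 1 := by field_simp
      _ = N := by simp

theorem sum_inv_sqrt_le (N : ℕ) :
    ∑ m ∈ Finset.Icc 1 N, 1 / (m : ℝ) * √m ≤ 2 * √N := by
  induction N with
  | zero => simp
  | succ N ih =>
    rw [Finset.sum_Icc_succ_top (by omega)]
    refine (add_le_add_left ih _).trans ?_
    have hs : (0 : ℝ) < √((N + 1 : ℕ) : ℝ) := Real.sqrt_pos.2 (by positivity)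
    have h1 : √((N + 1 : ℕ) : ℝ) ^ 2 = ((N + 1 : ℕ) : ℝ) := Real.sq_sqrt (by positivity)
    have h2 : √(N : ℝ) ^ 2 = N := Real.sq_sqrt (by positivity)
    have h3 : 1 / ((N + 1 : ℕ) : ℝ) * √((N + 1 : ℕ) : ℝ) = 1 / √((N + 1 : ℕ) : ℝ) := by
      nth_rewrite 1 [← h1]
      field_simp
    rw [h3]
    have h4 : (2 * √((N + 1 : ℕ) : ℝ) - 2 * √(N : ℝ)) * √((N + 1 : ℕ) : ℝ) ≥ 1 := by
      push_cast at h1 h2 ⊢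
      nlinarith [sq_nonneg (√((N : ℝ) + 1) - √(N : ℝ))]
    have h5 : 1 / √((N + 1 : ℕ) : ℝ) ≤ 2 * √((N + 1 : ℕ) : ℝ) - 2 * √(N : ℝ) := by
      rw [div_le_iff₀ hs]; exact h4
    linarith

theorem truncSum_le_sqrt (s : ℕ) : ∀ k : ℕ → ℕ, (∀ i, 1 ≤ k i) → 2 ≤ k s → ∀ r N : ℕ, 1 ≤ N →
    truncSum k r N ≤ ENNReal.ofReal (2 ^ (s + 1) * √N) := by
  have h0 : ∀ (k : ℕ → ℕ) (s N : ℕ), 1 ≤ N →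
      truncSum k 0 N ≤ ENNReal.ofReal (2 ^ (s + 1) * √N) := by
    intro k s N hN
    refine (truncSum_zero k N).trans ?_
    rw [ENNReal.one_le_ofReal]
    have h1 : (1 : ℝ) ≤ √N := by
      rw [Real.one_le_sqrt]; exact_mod_cast hN
    have h2 : (1 : ℝ) ≤ 2 ^ (s + 1) := one_le_pow₀ (by norm_num)
    nlinarith
  induction s with
  | zero =>
    intro k hk hs r N hN
    cases r with
    | zero => exact h0 k 0 N hN
    | succ r =>
      refine truncSum_step k r N (fun m => (m : ℝ)) (fun m => 2 ^ (0 + 1) * √(m : ℝ))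
        (fun m => by positivity) (truncSum_le_self r _ fun i => hk _) ?_
      refine le_trans ?_ ((sum_inv_sqrt_le N).trans (by simp))
      refine Finset.sum_le_sum fun m hm => ?_
      have h1 := (Finset.mem_Icc.1 hm).1
      have h2 : (1 : ℝ) ≤ m := by exact_mod_cast h1
      have h3 : (1 : ℝ) ≤ √m := Real.one_le_sqrt.2 h2
      calc 1 / (m : ℝ) ^ k 0 * m ≤ 1 / (m : ℝ) ^ 2 * m := by
            gcongr ?_ * _
            exact one_div_pow_le hs h1
        _ = 1 / (m : ℝ) * 1 := by field_simp
        _ ≤ 1 / (m : ℝ) * √m := by gcongr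
  | succ s ih =>
    intro k hk hs r N hN
    cases r with
    | zero => exact h0 k (s + 1) N hN
    | succ r =>
      refine truncSum_step k r N (fun m => 2 ^ (s + 1) * √(m : ℝ))
        (fun m => 2 ^ (s + 1 + 1) * √(m : ℝ))
        (fun m => by positivity) (ih (fun i => k (i + 1)) (fun i => hk _) hs r) ?_
      have h5 : ∑ m ∈ Finset.Icc 1 N, 1 / (m : ℝ) ^ k 0 * (2 ^ (s + 1) * √(m : ℝ))
          ≤ 2 ^ (s + 1) * ∑ m ∈ Finset.Icc 1 N, 1 / (m : ℝ) * √m := by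
        rw [Finset.mul_sum]
        refine Finset.sum_le_sum fun m hm => ?_
        have h1 := one_div_pow_le (hk 0) (Finset.mem_Icc.1 hm).1
        rw [pow_one] at h1
        calc 1 / (m : ℝ) ^ k 0 * (2 ^ (s + 1) * √(m : ℝ))
            ≤ 1 / (m : ℝ) * (2 ^ (s + 1) * √(m : ℝ)) := by gcongr
          _ = _ := by ring
      refine h5.trans ?_
      calc (2 : ℝ) ^ (s + 1) * ∑ m ∈ Finset.Icc 1 N, 1 / (m : ℝ) * √m
          ≤ 2 ^ (s + 1) * (2 * √N) := by gcongr; exact sum_inv_sqrt_le N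
        _ = 2 ^ (s + 1 + 1) * √(N : ℝ) := by ring

/-- For a sequence in `𝒯`, the partial star values are bounded, uniformly in the depth. -/
theorem exists_bound {k : ℕ → ℕ} (hk : k ∈ seqT) : ∃ C : ENNReal, C ≠ ⊤ ∧ ∀ r,
    ∑' n : starIndex (r + 1), ENNReal.ofReal (starTerm k (r + 1) n) ≤ C := by
  obtain ⟨h0, h1, h2⟩ := hk
  have key : ∃ c : ℝ, 0 ≤ c ∧ ∀ r m : ℕ, 1 ≤ m → ENNReal.ofReal (1 / (m : ℝ) ^ k 0) *
      truncSum (fun i => k (i + 1)) r m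
        ≤ ENNReal.ofReal (c * (1 / (m : ℝ) ^ (3 / 2 : ℝ))) := by
    have hpow : ∀ m : ℕ, 1 ≤ m → (m : ℝ) ^ (3 / 2 : ℝ) = m * √m := by
      intro m hm
      have : (0 : ℝ) < m := by exact_mod_cast hm
      rw [Real.sqrt_eq_rpow, show (3 / 2 : ℝ) = 1 + 1 / 2 by norm_num, Real.rpow_add this,
        Real.rpow_one]
    rcases Nat.eq_or_lt_of_le h0 with h | h
    · obtain ⟨s, hs1, hs2⟩ := h2 h.symm
      obtain ⟨t, rfl⟩ : ∃ t, s = t + 1 := ⟨s - 1, by omega⟩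
      refine ⟨2 ^ (t + 1), by positivity, fun r m hm => ?_⟩
      have hb := truncSum_le_sqrt t (fun i => k (i + 1)) (fun i => h1 _) hs2 r m hm
      refine (mul_le_mul_right hb _).trans ?_
      rw [← ENNReal.ofReal_mul (by positivity)]
      apply ENNReal.ofReal_le_ofReal
      rw [hpow m hm, ← h]
      have hm0 : (0 : ℝ) < m := by exact_mod_cast hm
      have hq : √(m : ℝ) ^ 2 = m := Real.sq_sqrt hm0.le
      have hs : (0 : ℝ) < √m := Real.sqrt_pos.2 hm0
      apply le_of_eq
      field_simp
      rw [hq]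
    · refine ⟨1, by norm_num, fun r m hm => ?_⟩
      have hb := truncSum_le_self r (fun i => k (i + 1)) (fun i => h1 _) m hm
      refine (mul_le_mul_right hb _).trans ?_
      rw [← ENNReal.ofReal_mul (by positivity)]
      apply ENNReal.ofReal_le_ofReal
      rw [hpow m hm, one_mul]
      have hm0 : (0 : ℝ) < m := by exact_mod_cast hm
      have hm1 : (1 : ℝ) ≤ m := by exact_mod_cast hm
      have hs : (1 : ℝ) ≤ √m := Real.one_le_sqrt.2 hm1
      have hq : √(m : ℝ) ^ 2 = m := Real.sq_sqrt hm0.le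
      calc 1 / (m : ℝ) ^ k 0 * m ≤ 1 / (m : ℝ) ^ 3 * m := by
            gcongr ?_ * _
            exact one_div_pow_le h hm
        _ = 1 / (m * (m : ℝ)) := by field_simp
        _ ≤ 1 / (m * √m) := by
            apply one_div_le_one_div_of_le (by positivity)
            gcongr
            nlinarith
  obtain ⟨c, hc, hkey⟩ := key
  refine ⟨∑' m : ℕ, ENNReal.ofReal (c * (1 / (m : ℝ) ^ (3 / 2 : ℝ))), ?_, fun r => ?_⟩
  · exact ((Real.summable_one_div_nat_rpow.2 (by norm_num)).mul_left c).tsum_ofReal_ne_top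
  · have hsig := sum_le_sigma k r Set.univ
    refine le_trans ?_ (hsig.trans ?_)
    · exact ENNReal.tsum_comp_le_tsum_of_injective
        (f := fun n : starIndex (r + 1) =>
          (⟨n.1, n.2, trivial⟩ : {n : Fin (r + 1) → ℕ // n ∈ starIndex (r + 1) ∧
            n 0 ∈ (Set.univ : Set ℕ)}))
        (fun a b h => Subtype.ext (congrArg (fun x => x.1) h))
        (fun n => ENNReal.ofReal (starTerm k (r + 1) n.1))
    · have h3 : ∀ m : {m : ℕ // 1 ≤ m ∧ m ∈ (Set.univ : Set ℕ)},
          ENNReal.ofReal (1 / ((m : ℕ) : ℝ) ^ k 0) * truncSum (fun i => k (i + 1)) r m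
            ≤ ENNReal.ofReal (c * (1 / ((m : ℕ) : ℝ) ^ (3 / 2 : ℝ))) :=
        fun m => hkey r m.1 m.2.1
      refine (ENNReal.tsum_le_tsum h3).trans ?_
      exact ENNReal.tsum_comp_le_tsum_of_injective Subtype.val_injective
        (fun m : ℕ => ENNReal.ofReal (c * (1 / (m : ℝ) ^ (3 / 2 : ℝ))))

/-- The series defining `ζ⋆(k₁, …, k_r)` converges for sequences in `𝒯` and `r ≥ 1`. -/
theorem summable_starTerm {k : ℕ → ℕ} (hk : k ∈ seqT) (r : ℕ) :
    Summable (fun n : starIndex (r + 1) => starTerm k (r + 1) n) := by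
  obtain ⟨C, hC, h⟩ := exists_bound hk
  have h0 : ∑' n : starIndex (r + 1), ENNReal.ofReal (starTerm k (r + 1) n) ≠ ⊤ :=
    ne_top_of_le_ne_top hC (h r)
  have h1 := ENNReal.summable_toReal h0
  refine h1.congr fun n => ?_
  exact ENNReal.toReal_ofReal (starTerm_nonneg _ _ _)

theorem zetaStar_le_succ {k : ℕ → ℕ} (hk : k ∈ seqT) (r : ℕ) :
    zetaStar k (r + 1) ≤ zetaStar k (r + 2) := by
  unfold zetaStar
  let φ : starIndex (r + 1) → starIndex (r + 2) := fun n =>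
    ⟨Fin.snoc (α := fun _ => ℕ) n.1 1, by
      refine ⟨fun i j hij => ?_, fun i => ?_⟩
      · induction j using Fin.lastCases with
        | last =>
          rw [Fin.snoc_last]
          induction i using Fin.lastCases with
          | last => simp
          | cast i => rw [Fin.snoc_castSucc]; exact n.2.2 i
        | cast j =>
          induction i using Fin.lastCases with
          | last => exact absurd hij (not_le.2 (Fin.castSucc_lt_last j))
          | cast i =>
            rw [Fin.snoc_castSucc, Fin.snoc_castSucc]
            exact n.2.1 (Fin.castSucc_le_castSucc_iff.1 hij)
      · induction i using Fin.lastCases with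
        | last => simp
        | cast i => rw [Fin.snoc_castSucc]; exact n.2.2 i⟩
  have hφ : Function.Injective φ := by
    intro a b h
    have h1 : (Fin.snoc (α := fun _ => ℕ) a.1 1 : Fin (r + 2) → ℕ)
        = Fin.snoc (α := fun _ => ℕ) b.1 1 := congrArg Subtype.val h
    apply Subtype.ext
    funext i
    have h2 := congrFun h1 i.castSucc
    rwa [Fin.snoc_castSucc, Fin.snoc_castSucc] at h2
  refine Summable.tsum_le_tsum_of_inj φ hφ (fun c _ => starTerm_nonneg _ _ _) (fun n => ?_)
    (summable_starTerm hk r) (summable_starTerm hk (r + 1))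
  apply le_of_eq
  unfold starTerm
  rw [Fin.prod_univ_castSucc (n := r + 1)]
  simp [φ]

/-- For sequences in `𝒯` the limit defining `η` exists, and `eta` is its value. -/
theorem tendsto_eta {k : ℕ → ℕ} (hk : k ∈ seqT) :
    Tendsto (fun r => zetaStar k r) atTop (𝓝 (eta k)) := by
  apply tendsto_nhds_limUnder
  obtain ⟨C, hC, h⟩ := exists_bound hk
  have hmono : Monotone (fun r => zetaStar k (r + 1)) :=
    monotone_nat_of_le_succ fun r => zetaStar_le_succ hk r
  have hb : BddAbove (range fun r => zetaStar k (r + 1)) := by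
    refine ⟨C.toReal, ?_⟩
    rintro _ ⟨r, rfl⟩
    have h1 := ENNReal.toReal_mono hC (h r)
    rw [← ENNReal.ofReal_tsum_of_nonneg (fun n => starTerm_nonneg _ _ _)
      (summable_starTerm hk r), ENNReal.toReal_ofReal
      (tsum_nonneg fun n => starTerm_nonneg _ _ _)] at h1
    exact h1
  exact ⟨_, (tendsto_add_atTop_iff_nat 1).1 (tendsto_atTop_ciSup hmono hb)⟩

end ZetaStar

namespace ZetaStar

/-! On sequences with all entries at least 2, `eta` behaves like the coding map of a self-similar
set in which the letter a contracts by 2^(-a). If two sequences share k₁, …, k_j, with sum S, their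
values differ by at most 6 · 2^(-S) (`abs_eta_sub_le`). If they first differ at the next place,
where the smaller entry is a, the values differ by at least 2^(-S-a)/3 (`le_eta_sub`). The base 2
appears because the terms with index 1 cancel in a difference of star sums, so the index 2 governs
the scale. The expected dimension s therefore solves ∑ 2^(-as) = 1 over the alphabet, that is, ∑ γ^a
= 1 with γ = 2^(-s).

Covering by cylinders gives the upper bound for any alphabet, finite or not (`dimH_eta_image_le`).
For the lower bound over [p, q] (`le_dimH_eta_image`), [0, 1) is coded by nested intervals whose
lengths are products of γ^a. Sending a point to the value of `eta` at its digits is a map with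
s-Hölder inverse, so its image has dimension at least s. The infinite alphabet [p, ∞) is exhausted
by finite ones, and its equation becomes that of α_p under x = 1/α. The bound for 𝒟_q is
monotonicity, since 𝒟_q contains 𝒯_2 ∩ 𝒟_q. -/

/-! ### Finite star sums and their limits -/

/-- The sum of `1 / (n₁ ^ k₁ ⋯ n_r ^ k_r)` over `N ≥ n₁ ≥ ⋯ ≥ n_r ≥ 1`, computed recursively. -/
noncomputable def starSum : (ℕ → ℕ) → ℕ → ℕ → ℝ
  | _, 0, _ => 1
  | k, r + 1, N => ∑ m ∈ Finset.Icc 1 N, 1 / (m : ℝ) ^ k 0 * starSum (fun i => k (i + 1)) r m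

open Classical in
/-- The tuples `N ≥ n₁ ≥ ⋯ ≥ n_r ≥ 1`. -/
noncomputable def starBox (r N : ℕ) : Finset (Fin r → ℕ) :=
  (Fintype.piFinset fun _ => Finset.range (N + 1)).filter (· ∈ starIndex r)

theorem mem_starBox {r N : ℕ} {n : Fin r → ℕ} :
    n ∈ starBox r N ↔ (∀ i, n i ≤ N) ∧ n ∈ starIndex r := by
  simp [starBox]

theorem cons_mem_starIndex {r m : ℕ} (hm : 1 ≤ m) {n : Fin r → ℕ} (hn : n ∈ starIndex r)
    (h : ∀ i, n i ≤ m) : (Fin.cons m n : Fin (r + 1) → ℕ) ∈ starIndex (r + 1) := by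
  refine ⟨fun i j hij => ?_, fun i => ?_⟩
  · induction i using Fin.cases with
    | zero =>
      induction j using Fin.cases with
      | zero => simp
      | succ j => simpa using h j
    | succ i =>
      induction j using Fin.cases with
      | zero => exact absurd hij (not_le.2 (Fin.succ_pos i))
      | succ j => simpa using hn.1 (Fin.succ_le_succ_iff.1 hij)
  · induction i using Fin.cases with
    | zero => simpa using hm
    | succ i => simpa using hn.2 i

theorem starSum_eq_sum_starBox (r : ℕ) : ∀ (k : ℕ → ℕ) (N : ℕ),
    starSum k r N = ∑ n ∈ starBox r N, starTerm k r n := by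
  induction r with
  | zero =>
    intro k N
    have : starBox 0 N = Finset.univ := by
      ext n
      simp only [mem_starBox, Finset.mem_univ, iff_true]
      exact ⟨fun i => i.elim0, fun i => i.elim0, fun i => i.elim0⟩
    simp [starSum, this, starTerm]
  | succ r ih =>
    intro k N
    simp only [starSum, ih, Finset.mul_sum]
    rw [Finset.sum_sigma' (Finset.Icc 1 N) (fun m => starBox r m)
      (fun m n => 1 / (m : ℝ) ^ k 0 * starTerm (fun i => k (i + 1)) r n)]
    refine Finset.sum_bij' (fun x _ => (Fin.cons x.1 x.2 : Fin (r + 1) → ℕ))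
      (fun n _ => ⟨n 0, Fin.tail n⟩) ?_ ?_ ?_ ?_ ?_
    · rintro ⟨m, n⟩ h
      simp only [Finset.mem_sigma, Finset.mem_Icc, mem_starBox] at h ⊢
      refine ⟨fun i => ?_, cons_mem_starIndex h.1.1 h.2.2 h.2.1⟩
      induction i using Fin.cases with
      | zero => simpa using h.1.2
      | succ i => simpa using (h.2.1 i).trans h.1.2
    · intro n h
      simp only [Finset.mem_sigma, Finset.mem_Icc, mem_starBox] at h ⊢
      exact ⟨⟨h.2.2 0, h.1 0⟩, fun i => h.2.1 (Fin.zero_le _),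
        fun i j hij => h.2.1 (Fin.succ_le_succ_iff.2 hij), fun i => h.2.2 _⟩
    · rintro ⟨m, n⟩ _
      simp
    · intro n _
      simp
    · rintro ⟨m, n⟩ _
      rw [starTerm_succ]
      simp

theorem tendsto_starSum {k : ℕ → ℕ} (hk : k ∈ seqT) (r : ℕ) :
    Tendsto (fun N => starSum k (r + 1) N) atTop (𝓝 (zetaStar k (r + 1))) := by
  have hs : HasSum ((starIndex (r + 1)).indicator (starTerm k (r + 1)))
      (zetaStar k (r + 1)) := by
    rw [← hasSum_subtype_iff_indicator]
    exact (summable_starTerm hk r).hasSum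
  have hm : Tendsto (fun N => Fintype.piFinset fun _ : Fin (r + 1) => Finset.range (N + 1))
      atTop atTop := by
    refine tendsto_atTop_finset_of_monotone (fun a b hab => ?_) fun n => ?_
    · exact Fintype.piFinset_subset _ _ fun _ => Finset.range_subset_range.2 (by omega)
    · refine ⟨∑ i, n i, ?_⟩
      simp only [Fintype.mem_piFinset, Finset.mem_range, Nat.lt_succ_iff]
      exact fun i => Finset.single_le_sum (f := n) (fun _ _ => Nat.zero_le _) (Finset.mem_univ i)
  refine (hs.comp hm).congr fun N => ?_
  classical
  rw [starSum_eq_sum_starBox, starBox, Finset.sum_filter]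
  exact Finset.sum_congr rfl fun n _ => by simp [Set.indicator_apply]

/-- Two successive limits, N → ∞ and then r → ∞, reduce every estimate on `eta` to one on finite
sums that is uniform in large r and N. -/
theorem le_eta_sub_of_starSum {k k' : ℕ → ℕ} (hk : k ∈ seqT) (hk' : k' ∈ seqT) {c : ℝ}
    (r₀ N₀ : ℕ) (h : ∀ r N, r₀ ≤ r → N₀ ≤ N → c ≤ starSum k r N - starSum k' r N) :
    c ≤ eta k - eta k' := by
  refine ge_of_tendsto ((tendsto_eta hk).sub (tendsto_eta hk')) ?_
  filter_upwards [eventually_ge_atTop (r₀ + 1)] with r hr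
  obtain ⟨r, rfl⟩ : ∃ t, r = t + 1 := ⟨r - 1, by omega⟩
  refine ge_of_tendsto ((tendsto_starSum hk r).sub (tendsto_starSum hk' r)) ?_
  filter_upwards [eventually_ge_atTop N₀] with N hN
  exact h _ _ (by omega) hN

/-! ### Estimates for finite star sums -/

theorem starSum_nonneg (r : ℕ) : ∀ (k : ℕ → ℕ) (N : ℕ), 0 ≤ starSum k r N := by
  induction r with
  | zero => intro k N; simp [starSum]
  | succ r ih =>
    intro k N
    exact Finset.sum_nonneg fun m _ => mul_nonneg (by positivity) (ih _ _)

theorem one_le_starSum (r : ℕ) : ∀ (k : ℕ → ℕ) (N : ℕ), 1 ≤ N → 1 ≤ starSum k r N := by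
  induction r with
  | zero => intro k N _; simp [starSum]
  | succ r ih =>
    intro k N hN
    have h := Finset.single_le_sum
      (f := fun m : ℕ => 1 / (m : ℝ) ^ k 0 * starSum (fun i => k (i + 1)) r m)
      (fun m _ => mul_nonneg (by positivity) (starSum_nonneg _ _ _))
      (Finset.mem_Icc.2 ⟨le_rfl, hN⟩)
    refine le_trans ?_ h
    simpa using ih _ 1 le_rfl

/-- The summand is 2/(m(m+1)), so the sum telescopes. Thus 2N/(N+1), which is 1 at N = 1, is a fixed
point of f ↦ ∑ f(m)/m², the recursion for entries equal to 2; this makes `starSum_le` uniform in the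
depth. -/
theorem sum_Icc_sq_mul_eq (N : ℕ) :
    ∑ m ∈ Finset.Icc 1 N, 1 / (m : ℝ) ^ 2 * (2 * m / (m + 1)) = 2 * (N : ℝ) / (N + 1) := by
  induction N with
  | zero => simp
  | succ N ih =>
    rw [Finset.sum_Icc_succ_top (by omega), ih]
    push_cast
    field_simp
    ring

theorem starSum_le (r : ℕ) : ∀ (k : ℕ → ℕ), (∀ i, 2 ≤ k i) → ∀ N : ℕ, 1 ≤ N →
    starSum k r N ≤ 2 * N / (N + 1) := by
  induction r with
  | zero =>
    intro k _ N hN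
    have h1 : (1 : ℝ) ≤ N := by exact_mod_cast hN
    rw [starSum, le_div_iff₀ (by positivity)]
    linarith
  | succ r ih =>
    intro k hk N _
    rw [← sum_Icc_sq_mul_eq]
    refine Finset.sum_le_sum fun m hm => ?_
    have h1 := (Finset.mem_Icc.1 hm).1
    exact mul_le_mul (one_div_pow_le (hk 0) h1) (ih _ (fun i => hk _) m h1)
      (starSum_nonneg _ _ _) (by positivity)

/-- A fixed point, vanishing at `1`, of `f ↦ fun N => ∑_{m ≤ N} (2 / m) ^ 2 f m`. -/
noncomputable def diffBound (N : ℕ) : ℝ :=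
  6 * N * (N - 1) / ((N + 1) * (N + 2))

theorem diffBound_nonneg (N : ℕ) : 0 ≤ diffBound N := by
  unfold diffBound
  rcases Nat.eq_zero_or_pos N with rfl | h
  · simp
  · have h1 : (0 : ℝ) ≤ N - 1 := sub_nonneg.2 (by exact_mod_cast h)
    positivity

theorem diffBound_le (N : ℕ) : diffBound N ≤ 6 := by
  unfold diffBound
  rw [div_le_iff₀ (by positivity)]
  nlinarith [(Nat.cast_nonneg N : (0 : ℝ) ≤ N)]

theorem sum_Icc_sq_mul_diffBound {N : ℕ} (hN : 1 ≤ N) :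
    ∑ m ∈ Finset.Icc 1 N, 4 / (m : ℝ) ^ 2 * diffBound m = diffBound N := by
  induction N, hN using Nat.le_induction with
  | base => simp [diffBound]
  | succ N hN ih =>
    rw [Finset.sum_Icc_succ_top (by omega), ih]
    unfold diffBound
    push_cast
    have : (0 : ℝ) < N := by exact_mod_cast hN
    field_simp
    ring

/-- This is the gain of 2^(-a) for each shared entry a. For m ≥ 2 it follows from m^(-a) ≤ 2^(-a)
(2/m)²; the term m = 1, which has no such decay, drops out because `diffBound` vanishes there. -/
theorem one_div_pow_mul_diffBound_le {a m : ℕ} (ha : 2 ≤ a) (hm : 1 ≤ m) :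
    1 / (m : ℝ) ^ a * diffBound m ≤ (1 / 2) ^ a * (4 / (m : ℝ) ^ 2 * diffBound m) := by
  rcases Nat.eq_or_lt_of_le hm with rfl | h
  · simp [diffBound]
  rw [← mul_assoc]
  refine mul_le_mul_of_nonneg_right ?_ (diffBound_nonneg m)
  have h2 : (2 : ℝ) ≤ m := by exact_mod_cast h
  obtain ⟨b, rfl⟩ : ∃ b, a = b + 2 := ⟨a - 2, by omega⟩
  have h3 : (1 / (m : ℝ)) ^ b ≤ (1 / 2) ^ b :=
    pow_le_pow_left₀ (by positivity) (one_div_le_one_div_of_le (by norm_num) h2) b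
  calc 1 / (m : ℝ) ^ (b + 2) = (1 / (m : ℝ)) ^ b * (1 / (m : ℝ) ^ 2) := by
        rw [pow_add, one_div_pow]; field_simp
    _ ≤ (1 / 2) ^ b * (1 / (m : ℝ) ^ 2) := by gcongr
    _ = (1 / 2) ^ (b + 2) * (4 / (m : ℝ) ^ 2) := by rw [pow_add]; ring

/-- Star sums of sequences that share their first `j` entries are close. -/
theorem abs_starSum_sub_le (j : ℕ) : ∀ (k k' : ℕ → ℕ), (∀ i, 2 ≤ k i) → (∀ i, 2 ≤ k' i) →
    (∀ i < j, k i = k' i) → ∀ r N : ℕ, 1 ≤ N →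
    |starSum k (j + r) N - starSum k' (j + r) N|
      ≤ (1 / 2) ^ (∑ i ∈ Finset.range j, k i) * diffBound N := by
  induction j with
  | zero =>
    intro k k' hk hk' _ r N hN
    have h1 : (1 : ℝ) ≤ N := by exact_mod_cast hN
    -- Without shared entries, both sums lie in [1, 2N/(N+1)]. Clearing denominators leaves the
    -- product (N-1)(N+1)(5N-2) to be nonnegative.
    have h2 : 2 * (N : ℝ) / (N + 1) - 1 ≤ diffBound N := by
      unfold diffBound
      rw [div_sub_one (by positivity), div_le_div_iff₀ (by positivity) (by positivity)]
      have h3 : (0 : ℝ) ≤ (N - 1) * ((N + 1) * (5 * N - 2)) :=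
        mul_nonneg (by linarith) (mul_nonneg (by linarith) (by linarith))
      nlinarith
    have a1 := one_le_starSum (0 + r) k N hN
    have a2 := one_le_starSum (0 + r) k' N hN
    have b1 := starSum_le (0 + r) k hk N hN
    have b2 := starSum_le (0 + r) k' hk' N hN
    rw [Finset.sum_range_zero, pow_zero, one_mul, abs_le]
    constructor <;> linarith
  | succ j ih =>
    intro k k' hk hk' h r N hN
    rw [show j + 1 + r = (j + r) + 1 by omega, starSum, starSum, ← h 0 (by omega),
      ← Finset.sum_sub_distrib]
    refine (Finset.abs_sum_le_sum_abs _ _).trans ?_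
    rw [← sum_Icc_sq_mul_diffBound hN, Finset.mul_sum]
    refine Finset.sum_le_sum fun m hm => ?_
    have h1 := (Finset.mem_Icc.1 hm).1
    rw [← mul_sub, abs_mul, abs_of_nonneg (by positivity)]
    refine (mul_le_mul_of_nonneg_left (ih _ _ (fun i => hk _) (fun i => hk' _)
      (fun i hi => h _ (by omega)) r m h1) (by positivity)).trans ?_
    rw [Finset.sum_range_succ', pow_add]
    calc _ = (1 / 2) ^ (∑ i ∈ Finset.range j, k (i + 1)) * (1 / (m : ℝ) ^ k 0 * diffBound m) := by
          ring
      _ ≤ (1 / 2) ^ (∑ i ∈ Finset.range j, k (i + 1)) *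
            ((1 / 2) ^ k 0 * (4 / (m : ℝ) ^ 2 * diffBound m)) := by
          exact mul_le_mul_of_nonneg_left (one_div_pow_mul_diffBound_le (hk 0) h1)
            (by positivity)
      _ = _ := by ring

/-- The comparison is termwise. The larger head exponent costs at least a factor m, while the tail
of `k'` is at most 2m/(m+1) and that of `k` at least 1. So the m-th difference is at least m^(-k₁)(1
- 2/(m+1)), which is 0 at m = 1 and 2^(-k₁)/3 at m = 2. -/
theorem starSum_sub_of_head_lt {k k' : ℕ → ℕ} (hk' : ∀ i, 2 ≤ k' i) (h : k 0 < k' 0)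
    (r N : ℕ) :
    0 ≤ starSum k (r + 1) N - starSum k' (r + 1) N ∧
      (2 ≤ N → (1 / 2) ^ k 0 / 3 ≤ starSum k (r + 1) N - starSum k' (r + 1) N) := by
  have key : ∀ m ∈ Finset.Icc 1 N, 1 / (m : ℝ) ^ k 0 * (1 - 2 / (m + 1)) ≤
      1 / (m : ℝ) ^ k 0 * starSum (fun i => k (i + 1)) r m -
        1 / (m : ℝ) ^ k' 0 * starSum (fun i => k' (i + 1)) r m := by
    intro m hm
    have h1 := (Finset.mem_Icc.1 hm).1
    have h0 : (0 : ℝ) < m := by exact_mod_cast h1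
    have h2 := one_le_starSum r (fun i => k (i + 1)) m h1
    have h3 := starSum_le r (fun i => k' (i + 1)) (fun i => hk' _) m h1
    have h4 : 1 / (m : ℝ) ^ k' 0 * starSum (fun i => k' (i + 1)) r m
        ≤ 1 / (m : ℝ) ^ (k 0 + 1) * (2 * m / (m + 1)) :=
      mul_le_mul (one_div_pow_le h h1) h3 (starSum_nonneg _ _ _) (by positivity)
    have h5 : 1 / (m : ℝ) ^ (k 0 + 1) * (2 * m / (m + 1))
        = 1 / (m : ℝ) ^ k 0 * (2 / (m + 1)) := by
      rw [pow_succ]; field_simp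
    have h6 : 1 / (m : ℝ) ^ k 0 * 1 ≤ 1 / (m : ℝ) ^ k 0 * starSum (fun i => k (i + 1)) r m := by
      gcongr
    rw [mul_sub]
    linarith
  have hpos : ∀ m ∈ Finset.Icc 1 N, 0 ≤ 1 / (m : ℝ) ^ k 0 * (1 - 2 / (m + 1)) := by
    intro m hm
    have h1 : (1 : ℝ) ≤ m := by exact_mod_cast (Finset.mem_Icc.1 hm).1
    refine mul_nonneg (by positivity) (sub_nonneg.2 ?_)
    rw [div_le_one (by positivity)]
    linarith
  rw [starSum, starSum, ← Finset.sum_sub_distrib]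
  refine ⟨Finset.sum_nonneg fun m hm => (hpos m hm).trans (key m hm), fun hN => ?_⟩
  refine le_trans ?_ (Finset.sum_le_sum key)
  refine le_trans (le_of_eq ?_) (Finset.single_le_sum hpos (Finset.mem_Icc.2 ⟨one_le_two, hN⟩))
  rw [one_div_pow]
  push_cast
  ring

/-- If `k` and `k'` first differ at position `j`, and `k j < k' j`, then the star sums of `k`
exceed those of `k'` by a definite amount. -/
theorem starSum_sub_of_lt (j : ℕ) : ∀ (k k' : ℕ → ℕ), (∀ i, 2 ≤ k' i) →
    (∀ i < j, k i = k' i) → k j < k' j → ∀ r N : ℕ,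
    0 ≤ starSum k (j + r + 1) N - starSum k' (j + r + 1) N ∧
      (2 ≤ N → (1 / 2) ^ (∑ i ∈ Finset.range (j + 1), k i) / 3
        ≤ starSum k (j + r + 1) N - starSum k' (j + r + 1) N) := by
  induction j with
  | zero =>
    intro k k' hk' _ h r N
    simpa using starSum_sub_of_head_lt hk' h (0 + r) N
  | succ j ih =>
    intro k k' hk' h hlt r N
    have ih' := ih (fun i => k (i + 1)) (fun i => k' (i + 1)) (fun i => hk' _)
      (fun i hi => h _ (by omega)) hlt r
    rw [show j + 1 + r + 1 = (j + r + 1) + 1 by omega, starSum, starSum, ← h 0 (by omega),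
      ← Finset.sum_sub_distrib]
    simp_rw [← mul_sub]
    have hpos : ∀ m ∈ Finset.Icc 1 N, 0 ≤ 1 / (m : ℝ) ^ k 0 *
        (starSum (fun i => k (i + 1)) (j + r + 1) m
          - starSum (fun i => k' (i + 1)) (j + r + 1) m) :=
      fun m _ => mul_nonneg (by positivity) (ih' m).1
    refine ⟨Finset.sum_nonneg hpos, fun hN => ?_⟩
    -- Nonnegativity for all N, carried through the induction, allows every term except m = 2 to be
    -- discarded; that term supplies the factor 2^(-k₁).
    refine le_trans ?_ (Finset.single_le_sum hpos (Finset.mem_Icc.2 ⟨one_le_two, hN⟩))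
    rw [Finset.sum_range_succ', pow_add, mul_comm, mul_div_assoc]
    push_cast
    rw [one_div_pow]
    exact mul_le_mul_of_nonneg_left ((ih' 2).2 le_rfl) (by positivity)

/-! ### Metric estimates for `eta` -/

theorem mem_seqT_of_two_le {k : ℕ → ℕ} (h : ∀ i, 2 ≤ k i) : k ∈ seqT :=
  ⟨h 0, fun i => one_le_two.trans (h i), fun _ => ⟨1, le_rfl, h 1⟩⟩

theorem abs_eta_sub_le {k k' : ℕ → ℕ} (hk : ∀ i, 2 ≤ k i) (hk' : ∀ i, 2 ≤ k' i) {j : ℕ}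
    (h : ∀ i < j, k i = k' i) :
    |eta k - eta k'| ≤ 6 * (1 / 2) ^ (∑ i ∈ Finset.range j, k i) := by
  have key : ∀ r N, j ≤ r → 1 ≤ N → |starSum k r N - starSum k' r N|
      ≤ 6 * (1 / 2) ^ (∑ i ∈ Finset.range j, k i) := by
    intro r N hr hN
    obtain ⟨t, rfl⟩ := Nat.exists_eq_add_of_le hr
    refine (abs_starSum_sub_le j k k' hk hk' h t N hN).trans ?_
    rw [mul_comm (6 : ℝ)]
    exact mul_le_mul_of_nonneg_left (diffBound_le N) (by positivity)
  have hT := mem_seqT_of_two_le hk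
  have hT' := mem_seqT_of_two_le hk'
  rw [abs_le]
  refine ⟨le_eta_sub_of_starSum hT hT' j 1 fun r N hr hN => (abs_le.1 (key r N hr hN)).1, ?_⟩
  have := le_eta_sub_of_starSum hT' hT (c := -(6 * (1 / 2) ^ (∑ i ∈ Finset.range j, k i))) j 1
    fun r N hr hN => by linarith [(abs_le.1 (key r N hr hN)).2]
  linarith

/-- The exponent includes the entry at which the sequences part, so the gap is comparable to the
size of the common cylinder only when the entries are bounded. -/
theorem le_eta_sub {k k' : ℕ → ℕ} (hk : ∀ i, 2 ≤ k i) (hk' : ∀ i, 2 ≤ k' i) {j : ℕ}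
    (h : ∀ i < j, k i = k' i) (hlt : k j < k' j) :
    (1 / 2) ^ (∑ i ∈ Finset.range (j + 1), k i) / 3 ≤ eta k - eta k' := by
  refine le_eta_sub_of_starSum (mem_seqT_of_two_le hk) (mem_seqT_of_two_le hk') (j + 1) 2
    fun r N hr hN => ?_
  obtain ⟨t, rfl⟩ := Nat.exists_eq_add_of_le hr
  rw [show j + 1 + t = j + t + 1 by omega]
  exact (starSum_sub_of_lt j k k' hk' h hlt t N).2 hN

/-! ### Upper bound by cylinder coverings -/

/-- Distributivity over words of length j: the sum over the level-j cylinders is the j-th power of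
the sum over the letters, also for infinite alphabets. -/
theorem tsum_prod_fin_eq_pow {ι : Type*} (f : ι → ENNReal) (j : ℕ) :
    ∑' w : Fin j → ι, ∏ i, f (w i) = (∑' a, f a) ^ j := by
  induction j with
  | zero => simp [tsum_fintype]
  | succ j ih =>
    rw [← (Fin.consEquiv fun _ : Fin (j + 1) => ι).tsum_eq, ENNReal.tsum_prod', pow_succ', ← ih,
      ← ENNReal.tsum_mul_right]
    refine tsum_congr fun a => ?_
    rw [← ENNReal.tsum_mul_left]
    refine tsum_congr fun w => ?_
    rw [Fin.prod_univ_succ]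
    simp [Fin.consEquiv]

theorem ofReal_mul_pow_sum_rpow (j : ℕ) (k : Fin j → ℕ) {s : ℝ} (hs : 0 ≤ s) :
    ENNReal.ofReal (6 * (1 / 2) ^ (∑ i, k i)) ^ s
      = ENNReal.ofReal 6 ^ s * ∏ i, ENNReal.ofReal ((1 / 2) ^ k i) ^ s := by
  rw [ENNReal.ofReal_mul (by norm_num), ENNReal.mul_rpow_of_nonneg _ _ hs,
    ← Finset.prod_pow_eq_pow_sum, ENNReal.ofReal_prod_of_nonneg (fun _ _ => by positivity),
    ENNReal.prod_rpow_of_nonneg hs]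

/-- The covering of `η` of the sequences over an alphabet by cylinders bounds its dimension. -/
theorem dimH_eta_image_le {A : Set ℕ} (hA : ∀ a ∈ A, 2 ≤ a) (s : NNReal)
    (h : ∑' a : A, ENNReal.ofReal ((1 / 2) ^ (a : ℕ)) ^ (s : ℝ) ≤ 1) :
    dimH (eta '' {k | ∀ i, k i ∈ A}) ≤ s := by
  let t : (j : ℕ) → (Fin j → A) → Set ℝ := fun j w =>
    eta '' {k | (∀ i, k i ∈ A) ∧ ∀ i : Fin j, k i = w i}
  have hdiam : ∀ j (w : Fin j → A),
      Metric.ediam (t j w) ≤ ENNReal.ofReal (6 * (1 / 2) ^ (∑ i, (w i : ℕ))) := by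
    intro j w
    refine Metric.ediam_le ?_
    rintro _ ⟨k, ⟨hk, hkw⟩, rfl⟩ _ ⟨k', ⟨hk', hkw'⟩, rfl⟩
    rw [edist_dist, Real.dist_eq]
    refine ENNReal.ofReal_le_ofReal ?_
    have := abs_eta_sub_le (fun i => hA _ (hk i)) (fun i => hA _ (hk' i)) (j := j)
      fun i hi => (hkw ⟨i, hi⟩).trans (hkw' ⟨i, hi⟩).symm
    rw [Finset.sum_range] at this
    simpa only [hkw] using this
  have htend : Tendsto (fun j : ℕ => ENNReal.ofReal (6 * (1 / 2) ^ j)) atTop (𝓝 0) := by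
    rw [← ENNReal.ofReal_zero]
    refine ENNReal.tendsto_ofReal ?_
    simpa using (tendsto_pow_atTop_nhds_zero_of_lt_one (r := (1 / 2 : ℝ)) (by norm_num)
      (by norm_num)).const_mul 6
  have hle := Measure.hausdorffMeasure_le_liminf_tsum (s : ℝ) (eta '' {k | ∀ i, k i ∈ A}) _
    htend t (Eventually.of_forall fun j w => (hdiam j w).trans (ENNReal.ofReal_le_ofReal ?_))
    (Eventually.of_forall fun j => ?_)
  · refine dimH_le_of_hausdorffMeasure_ne_top (ne_top_of_le_ne_top
      (b := ENNReal.ofReal 6 ^ (s : ℝ)) (by finiteness) (hle.trans ?_))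
    -- Every level gives the same bound 6^s, so a single level at which `b` is a lower bound is
    -- enough.
    refine liminf_le_of_le (by isBoundedDefault) fun b hb => ?_
    obtain ⟨j, hj⟩ := hb.exists
    refine hj.trans ?_
    calc ∑' w, Metric.ediam (t j w) ^ (s : ℝ)
        ≤ ∑' w : Fin j → A, ENNReal.ofReal 6 ^ (s : ℝ) *
            ∏ i, ENNReal.ofReal ((1 / 2) ^ (w i : ℕ)) ^ (s : ℝ) := by
          refine ENNReal.tsum_le_tsum fun w => ?_
          exact (ENNReal.rpow_le_rpow (hdiam j w) s.2).trans_eq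
            (ofReal_mul_pow_sum_rpow j (fun i => (w i : ℕ)) s.2)
      _ ≤ ENNReal.ofReal 6 ^ (s : ℝ) * 1 := by
          rw [ENNReal.tsum_mul_left, tsum_prod_fin_eq_pow
            (fun a : A => ENNReal.ofReal ((1 / 2) ^ (a : ℕ)) ^ (s : ℝ))]
          gcongr
          exact pow_le_one' h j
      _ = _ := mul_one _
  · refine mul_le_mul_of_nonneg_left ?_ (by norm_num)
    refine pow_le_pow_of_le_one (by norm_num) (by norm_num) ?_
    calc j = ∑ _i : Fin j, 1 := by simp
      _ ≤ _ := Finset.sum_le_sum fun i _ => one_le_two.trans (hA _ (w i).2)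
  · rintro _ ⟨k, hk, rfl⟩
    exact mem_iUnion.2 ⟨fun i => ⟨k i, hk i⟩, k, ⟨hk, fun _ => rfl⟩, rfl⟩

/-! ### Lower bound by digit expansions -/

theorem exists_partialSum_le_lt (f : ℕ → ℝ) {p q : ℕ} {x : ℝ} (hx : 0 ≤ x)
    (hxq : x < ∑ i ∈ Finset.Ico p q, f i) :
    ∃ a, p ≤ a ∧ a < q ∧ ∑ i ∈ Finset.Ico p a, f i ≤ x ∧ x < ∑ i ∈ Finset.Ico p (a + 1), f i := by
  classical
  have hex : ∃ b, x < ∑ i ∈ Finset.Ico p b, f i := ⟨q, hxq⟩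
  have hspec := Nat.find_spec hex
  have hp : p < Nat.find hex := by
    by_contra hcon
    rw [Finset.Ico_eq_empty (by omega), Finset.sum_empty] at hspec
    linarith
  obtain ⟨a, ha⟩ : ∃ a, Nat.find hex = a + 1 := ⟨Nat.find hex - 1, by omega⟩
  refine ⟨a, by omega, ?_, not_lt.1 (Nat.find_min hex (by omega)), ha ▸ hspec⟩
  have := Nat.find_min' hex hxq
  omega

/-- If `∑_{p ≤ i ≤ q} γ ^ i = 1`, the points of `[0, 1)` have digit expansions with digits in
`[p, q]` for which points with common digits `k₁, …, k_j` have distance at most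
`γ ^ (k₁ + ⋯ + k_j)`. -/
theorem exists_digits {p q : ℕ} {γ : ℝ} (h0 : 0 < γ) (hγ : ∑ i ∈ Finset.Icc p q, γ ^ i = 1) :
    ∃ d : Ico (0 : ℝ) 1 → ℕ → ℕ, (∀ x i, d x i ∈ Icc p q) ∧
      ∀ (x y : Ico (0 : ℝ) 1) (j : ℕ), (∀ i < j, d x i = d y i) →
        |(x : ℝ) - y| ≤ γ ^ (∑ i ∈ Finset.range j, d x i) := by
  -- Consecutive intervals of lengths γ^p, …, γ^q tile [0, 1). The digit names the interval
  -- containing x, and y is the position of x in it, rescaled to [0, 1).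
  have hdig : ∀ x : Ico (0 : ℝ) 1, ∃ a, a ∈ Icc p q ∧ ∃ y : Ico (0 : ℝ) 1,
      (x : ℝ) = ∑ i ∈ Finset.Ico p a, γ ^ i + γ ^ a * y := by
    rintro ⟨x, hx0, hx1⟩
    have hx1' : x < ∑ i ∈ Finset.Ico p (q + 1), γ ^ i := by
      rwa [Finset.Ico_add_one_right_eq_Icc, hγ]
    obtain ⟨a, hpa, haq, hle, hlt⟩ := exists_partialSum_le_lt (fun i => γ ^ i) hx0 hx1'
    have hpos : 0 < γ ^ a := pow_pos h0 a
    rw [Finset.sum_Ico_succ_top hpa] at hlt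
    refine ⟨a, ⟨hpa, by omega⟩, ⟨(x - ∑ i ∈ Finset.Ico p a, γ ^ i) / γ ^ a, ?_, ?_⟩, ?_⟩
    · exact div_nonneg (sub_nonneg.2 hle) hpos.le
    · rw [div_lt_one hpos]; linarith
    · rw [mul_div_cancel₀ _ hpos.ne']; ring
  choose a ha T hT using hdig
  -- The digits are the itinerary of x under the expanding map `T`.
  refine ⟨fun x i => a (T^[i] x), fun x i => ha _, fun x y j => ?_⟩
  induction j generalizing x y with
  | zero =>
    intro _
    rw [Finset.sum_range_zero, pow_zero, abs_le]
    constructor <;> linarith [x.2.1, x.2.2, y.2.1, y.2.2]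
  | succ j ih =>
    intro h
    have h1 : a x = a y := h 0 (by omega)
    have h2 := ih (T x) (T y) fun i hi => h (i + 1) (by omega)
    rw [hT x, hT y, ← h1, add_sub_add_left_eq_sub, ← mul_sub, abs_mul, abs_of_pos (pow_pos h0 _),
      Finset.sum_range_succ', pow_add, mul_comm]
    exact mul_le_mul_of_nonneg_right h2 (pow_pos h0 _).le

theorem dimH_Ico_zero_one : dimH (Ico (0 : ℝ) 1) = 1 := by
  rw [Real.dimH_of_nonempty_interior (by simp)]
  simp

/-- An expanding map of exponent `s` out of `[0, 1)` has image of dimension at least `s`. -/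
theorem le_dimH_of_abs_sub_le {E : Set ℝ} {s C : NNReal} (hs : 0 < s) (G : Ico (0 : ℝ) 1 → ℝ)
    (hG : ∀ x, G x ∈ E) (h : ∀ x y : Ico (0 : ℝ) 1, |(x : ℝ) - y| ≤ C * |G x - G y| ^ (s : ℝ)) :
    s ≤ dimH E := by
  have hinv : ∀ z ∈ range G, ∃ x : Ico (0 : ℝ) 1, G x = z := fun z hz => hz
  choose! g hg using hinv
  -- The inverse of `G` is s-Hölder and maps onto [0, 1), of dimension 1; an s-Hölder map multiplies
  -- dimension by at most 1/s.
  have hH : HolderOnWith C s (fun z => (g z : ℝ)) (range G) := by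
    intro z hz w hw
    have h1 := h (g z) (g w)
    rw [hg z hz, hg w hw] at h1
    rw [edist_dist, edist_dist, Real.dist_eq, Real.dist_eq,
      ENNReal.ofReal_rpow_of_nonneg (abs_nonneg _) s.coe_nonneg, ← ENNReal.ofReal_coe_nnreal,
      ← ENNReal.ofReal_mul C.coe_nonneg]
    exact ENNReal.ofReal_le_ofReal h1
  have hGinj : ∀ x, g (G x) = x := by
    intro x
    have h1 := h (g (G x)) x
    rw [hg _ (mem_range_self x), sub_self, abs_zero, Real.zero_rpow (by exact_mod_cast hs.ne'),
      mul_zero] at h1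
    exact Subtype.ext (sub_eq_zero.1 (abs_nonpos_iff.1 h1))
  have himg : (fun z => (g z : ℝ)) '' range G = Ico 0 1 := by
    ext x
    constructor
    · rintro ⟨z, _, rfl⟩; exact (g z).2
    · intro hx
      exact ⟨G ⟨x, hx⟩, mem_range_self _, by simp [hGinj]⟩
  have h1 := hH.dimH_image_le hs
  rw [himg, dimH_Ico_zero_one, ENNReal.le_div_iff_mul_le (by simp [hs.ne']) (by simp),
    one_mul] at h1
  exact h1.trans (dimH_mono (range_subset_iff.2 hG))

/-- This choice of s, with 2^(-s) = γ, turns ∑ 2^(-as) = 1 into ∑ γ^a = 1. -/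
theorem half_rpow_logb {γ : ℝ} (h0 : 0 < γ) :
    (1 / 2 : ℝ) ^ (Real.log (1 / γ) / Real.log 2) = γ := by
  rw [Real.rpow_def_of_pos (by norm_num), one_div, one_div, Real.log_inv, Real.log_inv]
  have : Real.log 2 ≠ 0 := (Real.log_pos (by norm_num)).ne'
  rw [show -Real.log 2 * (-Real.log γ / Real.log 2) = Real.log γ by field_simp]
  exact Real.exp_log h0

theorem logb_inv_pos {γ : ℝ} (h : γ ∈ Ioo (0 : ℝ) 1) :
    0 < Real.log (1 / γ) / Real.log 2 :=
  div_pos (Real.log_pos ((one_lt_div h.1).2 h.2)) (Real.log_pos (by norm_num))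

/-- If the digits of x and y agree with sum S and then differ, then |x - y| ≤ γ^S = (2^(-S))^s,
while the values of `eta` are at least 2^(-S-q)/3 apart. Hence the Hölder constant (3 · 2^q)^s,
finite because the digits are at most q. -/
theorem le_dimH_eta_image {p q : ℕ} (hp : 2 ≤ p) {γ : ℝ} (h : γ ∈ Ioo (0 : ℝ) 1)
    (hγ : ∑ i ∈ Finset.Icc p q, γ ^ i = 1) :
    ENNReal.ofReal (Real.log (1 / γ) / Real.log 2)
      ≤ dimH (eta '' {k | ∀ i, k i ∈ Icc p q}) := by
  obtain ⟨d, hd, hdist⟩ := exists_digits h.1 hγ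
  set s := Real.log (1 / γ) / Real.log 2 with hs_def
  have hs : 0 < s := logb_inv_pos h
  have hhalf : ∀ n : ℕ, γ ^ n = ((1 / 2 : ℝ) ^ n) ^ s := by
    intro n
    rw [← Real.rpow_natCast (1 / 2), ← Real.rpow_mul (by norm_num), mul_comm,
      Real.rpow_mul (by norm_num), half_rpow_logb h.1, Real.rpow_natCast]
  have h2 : ∀ x i, 2 ≤ d x i := fun x i => hp.trans (hd x i).1
  have hC : (0 : ℝ) ≤ (3 * 2 ^ q) ^ s := by positivity
  have key : ∀ (x y : Ico (0 : ℝ) 1) (j : ℕ), (∀ i < j, d x i = d y i) → d x j < d y j →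
      |(x : ℝ) - y| ≤ (3 * 2 ^ q) ^ s * |eta (d x) - eta (d y)| ^ s := by
    intro x y j hj hlt
    have h3 := le_eta_sub (h2 x) (h2 y) hj hlt
    have h4 : (1 / 2 : ℝ) ^ (∑ i ∈ Finset.range j, d x i)
        ≤ 3 * 2 ^ q * |eta (d x) - eta (d y)| := by
      rw [Finset.sum_range_succ, pow_add] at h3
      have h5 : (1 / 2 : ℝ) ^ q ≤ (1 / 2) ^ d x j :=
        pow_le_pow_of_le_one (by norm_num) (by norm_num) (hd x j).2
      have h6 : (1 / 2 : ℝ) ^ (∑ i ∈ Finset.range j, d x i) * (1 / 2) ^ q / 3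
          ≤ |eta (d x) - eta (d y)| := by
        refine le_trans ?_ (h3.trans (le_abs_self _))
        gcongr
      calc (1 / 2 : ℝ) ^ (∑ i ∈ Finset.range j, d x i)
          = 3 * 2 ^ q * ((1 / 2 : ℝ) ^ (∑ i ∈ Finset.range j, d x i) * (1 / 2) ^ q / 3) := by
            rw [one_div_pow (2 : ℝ) q]; field_simp
        _ ≤ _ := by gcongr
    refine (hdist x y j hj).trans ?_
    rw [hhalf, ← Real.mul_rpow (by positivity) (abs_nonneg _)]
    exact Real.rpow_le_rpow (by positivity) h4 hs.le
  have hfin := le_dimH_of_abs_sub_le (E := eta '' {k | ∀ i, k i ∈ Icc p q})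
    (s := ⟨s, hs.le⟩) (C := ⟨_, hC⟩) hs (fun x => eta (d x))
    (fun x => mem_image_of_mem _ (hd x)) fun x y => ?_
  · rwa [ENNReal.ofReal_eq_coe_nnreal hs.le]
  · change |(x : ℝ) - y| ≤ (3 * 2 ^ q) ^ s * |eta (d x) - eta (d y)| ^ s
    classical
    by_cases hxy : ∃ j, d x j ≠ d y j
    · have hmin : ∀ i < Nat.find hxy, d x i = d y i := fun i hi =>
        not_not.1 (Nat.find_min hxy hi)
      rcases lt_or_gt_of_ne (Nat.find_spec hxy) with hlt | hlt
      · exact key x y _ hmin hlt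
      · rw [abs_sub_comm, abs_sub_comm (eta (d x))]
        exact key y x _ (fun i hi => (hmin i hi).symm) hlt
    -- Equal digits force |x - y| ≤ γ^j for every j, so the left side is 0.
    · push Not at hxy
      refine le_trans (ge_of_tendsto' (tendsto_pow_atTop_nhds_zero_of_lt_one h.1.le h.2)
        fun j => (hdist x y j fun i _ => hxy i).trans ?_) (by positivity)
      refine pow_le_pow_of_le_one h.1.le h.2.le ?_
      calc j = ∑ _i ∈ Finset.range j, 1 := by simp
        _ ≤ _ := Finset.sum_le_sum fun i _ => one_le_two.trans (h2 x i)

/-! ### The roots α and γ -/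

theorem existsUnique_alpha {p : ℕ} (hp : 2 ≤ p) :
    ∃! α : ℝ, α ∈ Ioo (1 : ℝ) 2 ∧ α ^ (p - 1) * (α - 1) = 1 := by
  have hmono : StrictMonoOn (fun x : ℝ => x ^ (p - 1) * (x - 1)) (Ici 1) := by
    intro x hx y hy hxy
    have hx' : (1 : ℝ) ≤ x := hx
    have hpow : x ^ (p - 1) ≤ y ^ (p - 1) := pow_le_pow_left₀ (by linarith) hxy.le _
    exact mul_lt_mul' hpow (by linarith) (by linarith) (pow_pos (by linarith) _)
  have hcont : ContinuousOn (fun x : ℝ => x ^ (p - 1) * (x - 1)) (Icc 1 2) := by fun_prop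
  have h2 : (1 : ℝ) < 2 ^ (p - 1) := one_lt_pow₀ (by norm_num) (by omega)
  obtain ⟨α, hα, he⟩ := intermediate_value_Ioo (by norm_num) hcont
    (show (1 : ℝ) ∈ Ioo _ _ by
      constructor
      · norm_num
      · change (1 : ℝ) < 2 ^ (p - 1) * (2 - 1)
        linarith)
  exact ⟨α, ⟨hα, he⟩, fun β hβ => hmono.injOn hβ.1.1.le hα.1.le (hβ.2.trans he.symm)⟩

theorem strictMonoOn_sum_pow {p q : ℕ} (hp : 2 ≤ p) (hpq : p ≤ q) :
    StrictMonoOn (fun x : ℝ => ∑ i ∈ Finset.Icc p q, x ^ i) (Ici 0) := by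
  intro x hx y _ hxy
  refine Finset.sum_lt_sum_of_nonempty (Finset.nonempty_Icc.2 hpq) fun i hi => ?_
  exact pow_lt_pow_left₀ hxy hx (by have := (Finset.mem_Icc.1 hi).1; omega)

/-- The endpoint b is left free: b = 1 gives existence of γ_{p,q}, and b just above the root for [p,
∞) locates γ_{p,q} for large q. -/
theorem exists_gamma {p q : ℕ} (hp : 2 ≤ p) {b : ℝ} (hb : 0 < b)
    (h : 1 < ∑ i ∈ Finset.Icc p q, b ^ i) :
    ∃ γ ∈ Ioo (0 : ℝ) b, ∑ i ∈ Finset.Icc p q, γ ^ i = 1 := by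
  have hcont : ContinuousOn (fun x : ℝ => ∑ i ∈ Finset.Icc p q, x ^ i) (Icc 0 b) := by fun_prop
  obtain ⟨γ, hγ, he⟩ := intermediate_value_Ioo hb.le hcont
    (show (1 : ℝ) ∈ Ioo _ _ by
      refine ⟨?_, h⟩
      change ∑ i ∈ Finset.Icc p q, (0 : ℝ) ^ i < 1
      rw [Finset.sum_eq_zero fun i hi => zero_pow (by have := (Finset.mem_Icc.1 hi).1; omega)]
      norm_num)
  exact ⟨γ, hγ, he⟩

theorem existsUnique_gamma {p q : ℕ} (hp : 2 ≤ p) (hpq : p < q) :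
    ∃! γ : ℝ, γ ∈ Ioo (0 : ℝ) 1 ∧ ∑ i ∈ Finset.Icc p q, γ ^ i = 1 := by
  obtain ⟨γ, hγ, he⟩ := exists_gamma (q := q) hp one_pos (by
    simp only [one_pow, Finset.sum_const, Nat.card_Icc, nsmul_eq_mul, mul_one]
    exact_mod_cast (by omega : 1 < q + 1 - p))
  exact ⟨γ, ⟨hγ, he⟩, fun β hβ =>
    (strictMonoOn_sum_pow hp hpq.le).injOn hβ.1.1.le hγ.1.le (hβ.2.trans he.symm)⟩

/-! ### The dimension formulas -/

theorem seqTp_eq {p : ℕ} (hp : 2 ≤ p) : seqTp p = {k | ∀ i, k i ∈ Ici p} :=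
  Set.ext fun _ => ⟨fun h => h.2, fun h => ⟨mem_seqT_of_two_le fun i => hp.trans (h i), h⟩⟩

theorem seqTp_inter_seqD_eq {p : ℕ} (hp : 2 ≤ p) (q : ℕ) :
    seqTp p ∩ seqD q = {k | ∀ i, k i ∈ Icc p q} :=
  Set.ext fun _ => ⟨fun h i => ⟨h.1.2 i, h.2.2 i⟩, fun h =>
    have hT := mem_seqT_of_two_le fun i => hp.trans (h i).1
    ⟨⟨hT, fun i => (h i).1⟩, hT, fun i => (h i).2⟩⟩

theorem dimH_eta_image_le_log {A : Set ℕ} (hA : ∀ a ∈ A, 2 ≤ a) {γ : ℝ} (h : γ ∈ Ioo (0 : ℝ) 1)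
    (hγ : HasSum (fun a : A => γ ^ (a : ℕ)) 1) :
    dimH (eta '' {k | ∀ i, k i ∈ A}) ≤ ENNReal.ofReal (Real.log (1 / γ) / Real.log 2) := by
  have hs := logb_inv_pos h
  rw [ENNReal.ofReal_eq_coe_nnreal hs.le]
  refine dimH_eta_image_le hA _ (le_of_eq ?_)
  have : ∀ a : A, ENNReal.ofReal ((1 / 2) ^ (a : ℕ)) ^ (Real.log (1 / γ) / Real.log 2)
      = ENNReal.ofReal (γ ^ (a : ℕ)) := by
    intro a
    rw [ENNReal.ofReal_rpow_of_nonneg (by positivity) hs.le, ← Real.rpow_natCast,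
      ← Real.rpow_mul (by norm_num), mul_comm, Real.rpow_mul (by norm_num), half_rpow_logb h.1,
      Real.rpow_natCast]
  calc _ = ∑' a : A, ENNReal.ofReal (γ ^ (a : ℕ)) := tsum_congr this
    _ = 1 := by
      rw [← ENNReal.ofReal_tsum_of_nonneg (fun a => pow_nonneg h.1.le _) hγ.summable, hγ.tsum_eq,
        ENNReal.ofReal_one]

theorem dimH_eta_seqTp_inter_seqD {p q : ℕ} (hp : 2 ≤ p) {γ : ℝ} (h : γ ∈ Ioo (0 : ℝ) 1)
    (hγ : ∑ i ∈ Finset.Icc p q, γ ^ i = 1) :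
    dimH (eta '' (seqTp p ∩ seqD q)) = ENNReal.ofReal (Real.log (1 / γ) / Real.log 2) := by
  rw [seqTp_inter_seqD_eq hp]
  refine le_antisymm (dimH_eta_image_le_log (fun a ha => hp.trans ha.1) h ?_)
    (le_dimH_eta_image hp h hγ)
  have := Finset.hasSum (Finset.Icc p q) (fun a => γ ^ a)
  rw [hγ] at this
  have key : ∀ S : Set ℕ, S = Finset.Icc p q → HasSum (fun a : S => γ ^ (a : ℕ)) 1 := by
    rintro _ rfl
    exact this
  exact key _ (Finset.coe_Icc p q).symm

theorem hasSum_pow_Ici (p : ℕ) {x : ℝ} (h : x ∈ Ioo (0 : ℝ) 1) :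
    HasSum (fun a : Ici p => x ^ (a : ℕ)) (x ^ p / (1 - x)) := by
  let e : ℕ ≃ Ici p :=
    { toFun := fun n => ⟨n + p, Nat.le_add_left p n⟩
      invFun := fun a => a - p
      left_inv := fun n => by simp
      right_inv := fun a => Subtype.ext (Nat.sub_add_cancel a.2) }
  rw [← e.hasSum_iff, div_eq_mul_inv]
  refine ((hasSum_geometric_of_lt_one h.1.le h.2).mul_left (x ^ p)).congr_fun ?_
  intro n
  simp [e, pow_add, mul_comm]

/-- The series ∑_{i ≥ p} x^i equals 1, so at b > x some finite truncation already exceeds 1. The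
root for that finite alphabet is then below b. -/
theorem le_dimH_eta_seqTp {p : ℕ} (hp : 2 ≤ p) {x b : ℝ} (h : x ∈ Ioo (0 : ℝ) 1)
    (hx : x ^ p = 1 - x) (hb : b ∈ Ioo x 1) :
    ENNReal.ofReal (Real.log (1 / b) / Real.log 2) ≤ dimH (eta '' seqTp p) := by
  have hb0 : 0 < b := h.1.trans hb.1
  have hpow : x ^ p < b ^ p := pow_lt_pow_left₀ hb.1 h.1.le (by omega)
  -- The gap is positive because b^p > x^p = 1 - x > 1 - b. The truncated sum is (b^p -
  -- b^(p+n+1))/(1 - b), which exceeds 1 once b^n is below the gap.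
  obtain ⟨n, hn⟩ := exists_pow_lt_of_lt_one (show 0 < b ^ p - (1 - b) by linarith [hb.1]) hb.2
  have hlt : 1 < ∑ i ∈ Finset.Icc p (p + n), b ^ i := by
    have h1 : b ^ (p + n + 1) ≤ b ^ n := pow_le_pow_of_le_one hb0.le hb.2.le (by omega)
    have h2 : (∑ i ∈ Finset.Ico p (p + n + 1), b ^ i) * (b - 1) = b ^ (p + n + 1) - b ^ p :=
      geom_sum_Ico_mul b (by omega)
    rw [← Finset.Ico_add_one_right_eq_Icc]
    nlinarith [hb.2]
  obtain ⟨γ, hγ, he⟩ := exists_gamma hp hb0 hlt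
  have hγ' : γ ∈ Ioo (0 : ℝ) 1 := ⟨hγ.1, hγ.2.trans hb.2⟩
  calc ENNReal.ofReal (Real.log (1 / b) / Real.log 2)
      ≤ ENNReal.ofReal (Real.log (1 / γ) / Real.log 2) := by
        refine ENNReal.ofReal_le_ofReal ?_
        have h2 : 0 < Real.log 2 := Real.log_pos (by norm_num)
        have h3 : Real.log (1 / b) ≤ Real.log (1 / γ) :=
          Real.log_le_log (by positivity) (one_div_le_one_div_of_le hγ.1 hγ.2.le)
        gcongr
    _ = dimH (eta '' (seqTp p ∩ seqD (p + n))) := (dimH_eta_seqTp_inter_seqD hp hγ' he).symm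
    _ ≤ _ := dimH_mono (image_mono inter_subset_left)

theorem dimH_eta_seqTp {p : ℕ} (hp : 2 ≤ p) {x : ℝ} (h : x ∈ Ioo (0 : ℝ) 1)
    (hx : x ^ p = 1 - x) :
    dimH (eta '' seqTp p) = ENNReal.ofReal (Real.log (1 / x) / Real.log 2) := by
  refine le_antisymm ?_ ?_
  · rw [seqTp_eq hp]
    refine dimH_eta_image_le_log (fun a ha => hp.trans ha) h ?_
    have := hasSum_pow_Ici p h
    rwa [hx, div_self (sub_pos.2 h.2).ne'] at this
  -- The bound holds for every b in (x, 1); continuity lets b decrease to x.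
  · have hc : ContinuousAt (fun b : ℝ => ENNReal.ofReal (Real.log (1 / b) / Real.log 2)) x := by
      refine ENNReal.continuous_ofReal.continuousAt.comp ?_
      refine ContinuousAt.div_const (ContinuousAt.log ?_ (by have := h.1; positivity)) _
      exact continuousAt_const.div continuousAt_id h.1.ne'
    refine le_of_tendsto (hc.tendsto.mono_left nhdsWithin_le_nhds : Tendsto _ (𝓝[>] x) _) ?_
    filter_upwards [Ioo_mem_nhdsGT h.2] with b hb
    exact le_dimH_eta_seqTp hp h hx hb

end ZetaStar

theorem theorem1p5 :
    -- the root `α_p` exists and is unique, and it gives the dimension of `η(𝒯_p)`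
    (∀ p : ℕ, 2 ≤ p →
      (∃! α : ℝ, α ∈ Set.Ioo (1 : ℝ) 2 ∧ α ^ (p - 1) * (α - 1) = 1) ∧
      ∀ α : ℝ, α ∈ Set.Ioo (1 : ℝ) 2 → α ^ (p - 1) * (α - 1) = 1 →
        dimH (ZetaStar.eta '' ZetaStar.seqTp p)
          = ENNReal.ofReal (Real.log α / Real.log 2)) ∧
    -- the root `γ_{p,q}` exists and is unique, and it gives the dimension of `η(𝒯_p ∩ 𝒟_q)`
    (∀ p q : ℕ, 2 ≤ p → p < q →
      (∃! γ : ℝ, γ ∈ Set.Ioo (0 : ℝ) 1 ∧ ∑ i ∈ Finset.Icc p q, γ ^ i = 1) ∧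
      ∀ γ : ℝ, γ ∈ Set.Ioo (0 : ℝ) 1 → ∑ i ∈ Finset.Icc p q, γ ^ i = 1 →
        dimH (ZetaStar.eta '' (ZetaStar.seqTp p ∩ ZetaStar.seqD q))
          = ENNReal.ofReal (Real.log (1 / γ) / Real.log 2)) ∧
    -- the lower bound for the dimension of `η(𝒟_q)`, in terms of `γ_{2,q}`
    (∀ q : ℕ, 3 ≤ q →
      ∀ γ : ℝ, γ ∈ Set.Ioo (0 : ℝ) 1 → ∑ i ∈ Finset.Icc 2 q, γ ^ i = 1 →
        ENNReal.ofReal (Real.log (1 / γ) / Real.log 2)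
          ≤ dimH (ZetaStar.eta '' ZetaStar.seqD q)) := by
  refine ⟨fun p hp => ⟨ZetaStar.existsUnique_alpha hp, fun α hα he => ?_⟩,
    fun p q hp hpq => ⟨ZetaStar.existsUnique_gamma hp hpq,
      fun γ hγ he => ZetaStar.dimH_eta_seqTp_inter_seqD hp hγ he⟩,
    fun q _ γ hγ he => ?_⟩
  · have h0 : 0 < α := one_pos.trans hα.1
    -- With x = 1/α, the equation α^(p-1)(α - 1) = 1 reads x^p = 1 - x.
    have h1 : α⁻¹ ∈ Set.Ioo (0 : ℝ) 1 := ⟨inv_pos.2 h0, inv_lt_one_of_one_lt₀ hα.1⟩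
    have h2 : α⁻¹ ^ p = 1 - α⁻¹ := by
      obtain ⟨n, rfl⟩ : ∃ n, p = n + 1 := ⟨p - 1, by omega⟩
      rw [Nat.add_sub_cancel] at he
      rw [inv_pow]
      refine inv_eq_of_mul_eq_one_right ?_
      rwa [pow_succ, mul_assoc, mul_sub, mul_one, mul_inv_cancel₀ h0.ne']
    rw [ZetaStar.dimH_eta_seqTp hp h1 h2, one_div, inv_inv]
  · rw [← ZetaStar.dimH_eta_seqTp_inter_seqD le_rfl hγ he]
    exact dimH_mono (Set.image_mono Set.inter_subset_right)
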